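/- Let $d$ be a metric on the set $\{1,\dots,n\}$ (so $d(i,i)=0$, $d(i,j)=d(j,i)>0$ for $i\neq j$, and the triangle inequality holds). Assume that $d$ is \emph{generic}, that is, the polyhedron $$P_d=\{x\in\mathbb{R}^n : x_i+x_j\ge d(i,j)\ \text{for all } i,j \text{ (including } i=j)\}$$ is simple: each of its vertices lies in exactly $\dim P_d=n$ facets. Let $\Delta^d$ be the regular subdivision of the second hypersimplex $\operatorname{conv}\{e_i+e_j : 1\le i<j\le n\}$ induced by $d$; identifying the vertex $e_i+e_j$ with the edge $\{i,j\}$ of the complete graph $K_n$, its cells are the graphs $\Gamma$ on $\{1,\dots,n\}$ for which there is $\lambda\in\mathbb{R}^n$ with $\lambda_i+\lambda_j=d(i,j)$ for every edge $\{i,j\}$ of $\Gamma$ and $\lambda_i+\lambda_j>d(i,j)$ for every non-edge $\{i,j\}$, $i\ne j$, of $\Gamma$. A \emph{path} is a sequence of vertices in which consecutive vertices are adjacent (vertices and edges may be repeated); its length is the number of its steps. A \emph{tour} is a closed path; it is \emph{trivial} if each of its edges occurs in it at least twice, and \emph{even} if its length is even. Let $\Gamma$ be a connected (simple) graph on the vertex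 set $\{1,\dots,n\}$ with exactly $n$ edges and without non-trivial even tours. Then any two distinct non-adjacent vertices $v,w$ of $\Gamma$ are joined by a path of odd length in $\Gamma$, and $\Gamma$ is a cell of $\Delta^d$ if and only if for all $v\neq w$ with $\{v,w\}\notin E(\Gamma)$ $$d(v,w)\ \le\ \sum_{k=1}^{m-1}(-1)^{k-1}d(v_k,v_{k+1}),$$ where $(v=v_1,v_2,\dots,v_m=w)$ is any path of odd length $m-1$ from $v$ to $w$ in $\Gamma$. Here ``any'' may be read either way: the equivalence holds both when the inequality is required for every such path and when it is required for at least one such path for each non-edge $\{v,w\}$. -/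

import Mathlib

/-- `d` is a metric on the points `0, …, n - 1`. -/
structure IsFiniteMetric {n : ℕ} (d : Fin n → Fin n → ℝ) : Prop where
  self_eq_zero : ∀ i, d i i = 0
  pos : ∀ i j, i ≠ j → 0 < d i j
  symm : ∀ i j, d i j = d j i
  triangle : ∀ i j k, d i k ≤ d i j + d j k

/-- The polyhedron `P_d` of all `x` with `x i + x j ≥ d i j` for all `i`, `j`
(the diagonal case `i = j` included). -/
def metricPolyhedron {n : ℕ} (d : Fin n → Fin n → ℝ) : Set (Fin n → ℝ) :=
  {x | ∀ i j, d i j ≤ x i + x j}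

/-- The dimension of a convex set, that is, of its affine hull. -/
noncomputable def polyDim {n : ℕ} (P : Set (Fin n → ℝ)) : ℕ :=
  Module.finrank ℝ (vectorSpan ℝ P)

/-- `F` is a facet of the polyhedron `P`: a non-empty face of dimension `dim P - 1`.
A face is the set of maximizers over `P` of a linear functional. -/
def IsFacet {n : ℕ} (P F : Set (Fin n → ℝ)) : Prop :=
  F.Nonempty ∧ IsExposed ℝ P F ∧ polyDim F + 1 = polyDim P

/-- A pointed polyhedron is simple if each of its vertices lies in exactly `dim P` facets. -/
def IsSimplePolyhedron {n : ℕ} (P : Set (Fin n → ℝ)) : Prop :=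
  ∀ v ∈ P.extremePoints ℝ, {F : Set (Fin n → ℝ) | IsFacet P F ∧ v ∈ F}.encard = polyDim P

/-- A generic metric: a metric `d` whose polyhedron `P_d` is simple. -/
def IsGenericMetric {n : ℕ} (d : Fin n → Fin n → ℝ) : Prop :=
  IsFiniteMetric d ∧ IsSimplePolyhedron (metricPolyhedron d)

/-- The regular subdivision `Δ^d` of the second hypersimplex, given by its cells. The vertex
`e_i + e_j` of the hypersimplex is the edge `{i, j}` of the complete graph, so that a cell is a
graph `Γ` on the points; `Γ` is a cell if there is a height function `h` (its entries may be
negative) with `h i + h j = d i j` on the edges and `h i + h j > d i j` on the non-edges. -/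
def hypersimplexSubdivision {n : ℕ} (d : Fin n → Fin n → ℝ) : Set (SimpleGraph (Fin n)) :=
  {Γ | ∃ h : Fin n → ℝ,
    (∀ i j, Γ.Adj i j → h i + h j = d i j) ∧
    (∀ i j, i ≠ j → ¬ Γ.Adj i j → d i j < h i + h j)}

/-- A tour (a closed walk) is trivial if each of its edges occurs in it at least twice. -/
def IsTrivialTour {n : ℕ} {Γ : SimpleGraph (Fin n)} {v : Fin n} (p : Γ.Walk v v) : Prop :=
  ∀ e ∈ p.edges, 2 ≤ p.edges.count e

/-- `Γ` contains a non-trivial tour of even length. -/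
def HasNontrivialEvenTour {n : ℕ} (Γ : SimpleGraph (Fin n)) : Prop :=
  ∃ (v : Fin n) (p : Γ.Walk v v), Even p.length ∧ ¬ IsTrivialTour p

/-- The alternating sum `d (v₀, v₁) - d (v₁, v₂) + d (v₂, v₃) - …` along the walk
`v₀, v₁, v₂, …`. -/
def alternatingSum {n : ℕ} (d : Fin n → Fin n → ℝ) {Γ : SimpleGraph (Fin n)} {v w : Fin n}
    (p : Γ.Walk v w) : ℝ :=
  ∑ k ∈ Finset.range p.length, (-1) ^ k * d (p.getVert k) (p.getVert (k + 1))

/-! A connected graph with as many edges as vertices has a cycle, which is odd by the tour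
hypothesis, so odd walks join all pairs of vertices. Then vanishing edge sums force a vector to
vanish, and since there are `n` edges, exactly one `h` satisfies `h i + h j = d i j` on the edges.
Along an odd walk from `v` to `w` the alternating sum telescopes to `h v + h w`, whichever walk is
chosen, so both readings of the criterion say that `h` satisfies the weak inequalities off `Γ`.

Genericity makes them strict (`lt_of_potential`): `h` is a vertex of the polyhedron, the edges of
`Γ` already supply `n` distinct facets through it, and a tight non-edge would supply one more. -/

open Filter Topology

/-! ### Parity of walks and the potential of `Γ` -/

section Walks

variable {n : ℕ} {Γ : SimpleGraph (Fin n)}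

/-- The alternating sum along a walk telescopes when `d` is the sum of potentials on edges. -/
lemma alternatingSum_eq_of_potential (d : Fin n → Fin n → ℝ) (h : Fin n → ℝ)
    (hh : ∀ i j, Γ.Adj i j → h i + h j = d i j) {v w : Fin n} (p : Γ.Walk v w) :
    alternatingSum d p = h v - (-1) ^ p.length * h w := by
  induction p with
  | nil => simp [alternatingSum]
  | @cons u v w hadj q ih =>
    have hstep : alternatingSum d (SimpleGraph.Walk.cons hadj q) = d u v - alternatingSum d q := by
      simp only [alternatingSum, SimpleGraph.Walk.length_cons]
      rw [Finset.sum_range_succ']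
      simp only [SimpleGraph.Walk.getVert_cons_succ, pow_succ, SimpleGraph.Walk.getVert_zero,
        pow_zero, one_mul]
      rw [sub_eq_add_neg, ← Finset.sum_neg_distrib, add_comm]
      congr 1
      exact Finset.sum_congr rfl fun k _ => by ring
    rw [hstep, ih, ← hh u v hadj, SimpleGraph.Walk.length_cons, pow_succ]
    ring

lemma alternatingSum_eq_add_of_odd (d : Fin n → Fin n → ℝ) (h : Fin n → ℝ)
    (hh : ∀ i j, Γ.Adj i j → h i + h j = d i j) {v w : Fin n} (p : Γ.Walk v w)
    (hp : Odd p.length) : alternatingSum d p = h v + h w := by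
  rw [alternatingSum_eq_of_potential d h hh p, hp.neg_one_pow]
  ring

/-- A cycle is a non-trivial tour. -/
lemma odd_length_of_isCycle (htour : ¬ HasNontrivialEvenTour Γ) {u : Fin n} {c : Γ.Walk u u}
    (hc : c.IsCycle) : Odd c.length := by
  rw [← Nat.not_even_iff_odd]
  intro heven
  refine htour ⟨u, c, heven, fun htriv => ?_⟩
  have hne : c.edges ≠ [] := fun h => by
    have := hc.three_le_length
    rw [← SimpleGraph.Walk.length_edges, h] at this
    simp at this
  obtain ⟨e, he⟩ := List.exists_mem_of_ne_nil _ hne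
  have h2 := htriv e he
  have h1 := List.nodup_iff_count_le_one.mp hc.edges_nodup e
  omega

lemma exists_odd_closed_walk (hconn : Γ.Connected) (hcard : Γ.edgeSet.ncard = n)
    (htour : ¬ HasNontrivialEvenTour Γ) : ∃ (u : Fin n) (c : Γ.Walk u u), Odd c.length := by
  have hcyc : ¬ Γ.IsAcyclic := fun hac => by
    have htree : Γ.IsTree := ⟨hconn, hac⟩
    have h := (SimpleGraph.isTree_iff_connected_and_card.mp htree).2
    rw [Nat.card_coe_set_eq, hcard] at h
    simp at h
  simp only [SimpleGraph.IsAcyclic, not_forall, not_not] at hcyc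
  obtain ⟨u, c, hc⟩ := hcyc
  exact ⟨u, c, odd_length_of_isCycle htour hc⟩

/-- A detour around the odd closed walk at `u` changes the parity of a walk through `u`. -/
lemma exists_odd_walk (hconn : Γ.Connected) {u : Fin n} {c : Γ.Walk u u} (hc : Odd c.length)
    (v w : Fin n) : ∃ p : Γ.Walk v w, Odd p.length := by
  obtain ⟨q⟩ := hconn.preconnected v u
  obtain ⟨r⟩ := hconn.preconnected u w
  rcases Nat.even_or_odd (q.append r).length with h | h
  · refine ⟨q.append (c.append r), ?_⟩
    simp only [SimpleGraph.Walk.length_append] at h ⊢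
    rw [show q.length + (c.length + r.length) = c.length + (q.length + r.length) by ring]
    exact hc.add_even h
  · exact ⟨_, h⟩

/-- The value of `x` changes sign at each step, so an odd closed walk at `v` gives `2 * x v = 0`. -/
lemma eq_zero_of_edge_sums_eq_zero (hodd : ∀ v w : Fin n, ∃ p : Γ.Walk v w, Odd p.length)
    (x : Fin n → ℝ) (hx : ∀ i j, Γ.Adj i j → x i + x j = 0) : x = 0 := by
  funext v
  obtain ⟨p, hp⟩ := hodd v v
  have h := alternatingSum_eq_add_of_odd (fun _ _ => 0) x hx p hp
  simp only [alternatingSum, mul_zero, Finset.sum_const_zero] at h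
  simp only [Pi.zero_apply]
  linarith

/-- The linear map taking a vector of vertex values to the sums over the edges. -/
def edgeSumMap (Γ : SimpleGraph (Fin n)) : (Fin n → ℝ) →ₗ[ℝ] (Γ.edgeSet → ℝ) where
  toFun x e := Sym2.lift ⟨fun i j => x i + x j, fun _ _ => add_comm _ _⟩ e.1
  map_add' x y := by
    funext ⟨e, he⟩
    induction e using Sym2.ind
    simp only [Sym2.lift_mk, Pi.add_apply]
    ring
  map_smul' a x := by
    funext ⟨e, he⟩
    induction e using Sym2.ind
    simp [mul_add]

/-- The linear system is square, so injectivity gives solvability for every right-hand side. -/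
lemma exists_potential (hcard : Γ.edgeSet.ncard = n)
    (hodd : ∀ v w : Fin n, ∃ p : Γ.Walk v w, Odd p.length) (d : Fin n → Fin n → ℝ)
    (hsymm : ∀ i j, d i j = d j i) : ∃ h : Fin n → ℝ, ∀ i j, Γ.Adj i j → h i + h j = d i j := by
  classical
  have hinj : Function.Injective (edgeSumMap Γ) := by
    rw [injective_iff_map_eq_zero]
    intro x hx
    refine eq_zero_of_edge_sums_eq_zero hodd x fun i j hij => ?_
    exact congrFun hx ⟨s(i, j), hij⟩
  have hfin : Module.finrank ℝ (Fin n → ℝ) = Module.finrank ℝ (Γ.edgeSet → ℝ) := by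
    rw [Module.finrank_fin_fun, Module.finrank_fintype_fun_eq_card, ← Nat.card_eq_fintype_card,
      Nat.card_coe_set_eq, hcard]
  obtain ⟨h, hh⟩ := (LinearMap.injective_iff_surjective_of_finrank_eq_finrank hfin).mp hinj
    fun e => Sym2.lift ⟨d, hsymm⟩ e.1
  exact ⟨h, fun i j hij => congrFun hh ⟨s(i, j), hij⟩⟩

/-- If every edge met `i`, the vector that is `1` at `i` and `-1` elsewhere would have zero edge
sums. -/
lemma exists_edge_avoiding (hodd : ∀ v w : Fin n, ∃ p : Γ.Walk v w, Odd p.length) (i : Fin n) :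
    ∃ j k, Γ.Adj j k ∧ j ≠ i ∧ k ≠ i := by
  by_contra! hall
  have h := eq_zero_of_edge_sums_eq_zero hodd (fun k => if k = i then 1 else -1) fun j k hjk => by
    by_cases hj : j = i
    · have hk : k ≠ i := fun hk => hjk.ne (hj.trans hk.symm)
      simp [hj, hk]
    · simp [hj, hall j k hjk hj]
  simpa using congrFun h i

end Walks

/-! ### Dimension and facets of the polyhedron -/

section Polyhedron

variable {n : ℕ} {d : Fin n → Fin n → ℝ}

/-- A direction along which all tight constraints stay tight can be followed for a while. -/
lemma exists_pos_add_smul_mem_metricPolyhedron {x u : Fin n → ℝ} (hx : x ∈ metricPolyhedron d)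
    (hu : ∀ a b, x a + x b = d a b → u a + u b = 0) :
    ∃ ε : ℝ, 0 < ε ∧ x + ε • u ∈ metricPolyhedron d := by
  have hev : ∀ᶠ ε in 𝓝[>] (0 : ℝ), ∀ a b, d a b ≤ (x + ε • u) a + (x + ε • u) b := by
    refine eventually_all.2 fun a => eventually_all.2 fun b => ?_
    simp only [Pi.add_apply, Pi.smul_apply, smul_eq_mul]
    rcases (hx a b).eq_or_lt with heq | hlt
    · refine Eventually.of_forall fun ε => le_of_eq ?_
      linear_combination heq - ε * hu a b heq.symm
    · have hcont : Continuous fun ε : ℝ => x a + ε * u a + (x b + ε * u b) := by fun_prop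
      have hlim := hcont.tendsto 0
      simp only [zero_mul, add_zero] at hlim
      exact ((hlim.eventually (lt_mem_nhds hlt)).filter_mono nhdsWithin_le_nhds).mono
        fun _ h => h.le
  obtain ⟨ε, hε, hpos⟩ := (hev.and self_mem_nhdsWithin).exists
  exact ⟨ε, hpos, hε⟩

lemma mem_vectorSpan_of_add_smul_mem {s : Set (Fin n → ℝ)} {x u : Fin n → ℝ} {ε : ℝ}
    (hε : 0 < ε) (hx : x ∈ s) (hxu : x + ε • u ∈ s) : u ∈ vectorSpan ℝ s := by
  have h := vsub_mem_vectorSpan ℝ hxu hx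
  rw [vsub_eq_sub, add_sub_cancel_left] at h
  exact (Submodule.smul_mem_iff _ hε.ne').mp h

/-- A number larger than all distances. -/
noncomputable def distBound (d : Fin n → Fin n → ℝ) : ℝ := 1 + ∑ a, ∑ b, |d a b|

lemma lt_distBound (d : Fin n → Fin n → ℝ) (a b : Fin n) : d a b < distBound d := by
  have h1 : |d a b| ≤ ∑ b, |d a b| :=
    Finset.single_le_sum (f := fun b => |d a b|) (fun _ _ => abs_nonneg _) (Finset.mem_univ b)
  have h2 : ∑ b, |d a b| ≤ ∑ a, ∑ b, |d a b| :=
    Finset.single_le_sum (f := fun a => ∑ b, |d a b|)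
      (fun _ _ => Finset.sum_nonneg fun _ _ => abs_nonneg _) (Finset.mem_univ a)
  have h3 := le_abs_self (d a b)
  unfold distBound
  linarith

lemma distBound_pos (d : Fin n → Fin n → ℝ) : 0 < distBound d := by
  have : 0 ≤ ∑ a, ∑ b, |d a b| :=
    Finset.sum_nonneg fun _ _ => Finset.sum_nonneg fun _ _ => abs_nonneg _
  unfold distBound
  linarith

lemma polyDim_metricPolyhedron (d : Fin n → Fin n → ℝ) : polyDim (metricPolyhedron d) = n := by
  -- The constant vector `distBound d` has no tight constraint, so every direction can be followed
  -- from it.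
  have hlt : ∀ a b, d a b < distBound d + distBound d := fun a b => by
    have := lt_distBound d a b
    have := distBound_pos d
    linarith
  have hmem : (fun _ => distBound d) ∈ metricPolyhedron d := fun a b => (hlt a b).le
  have htop : vectorSpan ℝ (metricPolyhedron d) = ⊤ := by
    rw [Submodule.eq_top_iff']
    intro u
    obtain ⟨ε, hε, h⟩ := exists_pos_add_smul_mem_metricPolyhedron (u := u) hmem
      fun a b hab => absurd hab (hlt a b).ne'
    exact mem_vectorSpan_of_add_smul_mem hε hmem h
  rw [polyDim, htop, finrank_top, Module.finrank_fin_fun]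

/-- The face of `metricPolyhedron d` on which the constraint of the pair `e` is tight. -/
def pairFace (d : Fin n → Fin n → ℝ) (e : Sym2 (Fin n)) : Set (Fin n → ℝ) :=
  {x ∈ metricPolyhedron d | ∀ a b, s(a, b) = e → x a + x b = d a b}

lemma mem_pairFace_mk (hd : IsFiniteMetric d) {i j : Fin n} {x : Fin n → ℝ} :
    x ∈ pairFace d s(i, j) ↔ x ∈ metricPolyhedron d ∧ x i + x j = d i j := by
  refine and_congr_right fun _ => ⟨fun h => h i j rfl, fun h a b hab => ?_⟩
  rcases Sym2.eq_iff.mp hab with ⟨rfl, rfl⟩ | ⟨rfl, rfl⟩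
  · exact h
  · rw [add_comm, h, hd.symm]

/-- For distinct points, some point of the polyhedron is tight at this pair only. -/
lemma exists_tight_only_at_pair (hd : IsFiniteMetric d) {i j : Fin n} (hij : i ≠ j) :
    ∃ x ∈ pairFace d s(i, j), ∀ a b, s(a, b) ≠ s(i, j) → d a b < x a + x b := by
  have hM := distBound_pos d
  have hpos := hd.pos i j hij
  -- The value `d i j / 2` makes the pair tight and, being positive, keeps the diagonal constraints
  -- at `i` and `j` strict; `distBound d` keeps all others strict.
  let x : Fin n → ℝ := fun k => if k = i ∨ k = j then d i j / 2 else distBound d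
  have hi : ∀ k, k = i ∨ k = j → x k = d i j / 2 := fun k hk => if_pos hk
  have ho : ∀ k, ¬ (k = i ∨ k = j) → x k = distBound d := fun k hk => if_neg hk
  have hstrict : ∀ a b, s(a, b) ≠ s(i, j) → d a b < x a + x b := by
    intro a b hab
    have hlt := lt_distBound d a b
    by_cases ha : a = i ∨ a = j <;> by_cases hb : b = i ∨ b = j
    · have hab' : a = b := by
        rcases ha with rfl | rfl <;> rcases hb with rfl | rfl
        · rfl
        · exact absurd rfl hab
        · exact absurd Sym2.eq_swap hab
        · rfl
      rw [hi a ha, hi b hb, hab', hd.self_eq_zero]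
      linarith
    · rw [hi a ha, ho b hb]; linarith
    · rw [ho a ha, hi b hb]; linarith
    · rw [ho a ha, ho b hb]; linarith
  have htight : x i + x j = d i j := by
    rw [hi i (Or.inl rfl), hi j (Or.inr rfl)]; ring
  refine ⟨x, (mem_pairFace_mk hd).2 ⟨fun a b => ?_, htight⟩, hstrict⟩
  by_cases hab : s(a, b) = s(i, j)
  · rcases Sym2.eq_iff.mp hab with ⟨rfl, rfl⟩ | ⟨rfl, rfl⟩
    · exact htight.ge
    · rw [hd.symm, add_comm]; exact htight.ge
  · exact (hstrict a b hab).le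

lemma pairFace_injOn (hd : IsFiniteMetric d) :
    Set.InjOn (pairFace d) {e : Sym2 (Fin n) | ¬ e.IsDiag} := by
  intro e he f _ hef
  induction e using Sym2.ind with | _ i j
  induction f using Sym2.ind with | _ a b
  obtain ⟨x, hx, hstrict⟩ := exists_tight_only_at_pair hd (i := i) (j := j) he
  by_contra hne
  rw [hef] at hx
  exact (hstrict a b (Ne.symm hne)).ne' ((mem_pairFace_mk hd).1 hx).2

/-- The functional `x ↦ x i + x j`. -/
def pairFunctional (i j : Fin n) : StrongDual ℝ (Fin n → ℝ) :=
  ContinuousLinearMap.proj (R := ℝ) (φ := fun _ : Fin n => ℝ) i +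
    ContinuousLinearMap.proj (R := ℝ) (φ := fun _ : Fin n => ℝ) j

@[simp]
lemma pairFunctional_apply (i j : Fin n) (x : Fin n → ℝ) : pairFunctional i j x = x i + x j := rfl

lemma polyDim_pairFace (hd : IsFiniteMetric d) {i j : Fin n} (hij : i ≠ j) :
    polyDim (pairFace d s(i, j)) + 1 = n := by
  obtain ⟨x, hx, hstrict⟩ := exists_tight_only_at_pair hd hij
  have hspan : vectorSpan ℝ (pairFace d s(i, j)) =
      LinearMap.ker (pairFunctional i j : (Fin n → ℝ) →ₗ[ℝ] ℝ) := by
    apply le_antisymm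
    · rw [vectorSpan, Submodule.span_le]
      rintro _ ⟨y, hy, z, hz, rfl⟩
      have h1 := ((mem_pairFace_mk hd).1 hy).2
      have h2 := ((mem_pairFace_mk hd).1 hz).2
      simp only [vsub_eq_sub, SetLike.mem_coe, LinearMap.mem_ker, ContinuousLinearMap.coe_coe,
        pairFunctional_apply, Pi.sub_apply]
      linarith
    · intro u hu
      replace hu : u i + u j = 0 := hu
      obtain ⟨ε, hε, h⟩ := exists_pos_add_smul_mem_metricPolyhedron (u := u) hx.1
        fun a b hab => by
          by_cases hs : s(a, b) = s(i, j)
          · rcases Sym2.eq_iff.mp hs with ⟨rfl, rfl⟩ | ⟨rfl, rfl⟩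
            · exact hu
            · rwa [add_comm]
          · exact absurd hab (hstrict a b hs).ne'
      refine mem_vectorSpan_of_add_smul_mem hε hx ((mem_pairFace_mk hd).2 ⟨h, ?_⟩)
      simp only [Pi.add_apply, Pi.smul_apply, smul_eq_mul]
      linear_combination ((mem_pairFace_mk hd).1 hx).2 + ε * hu
  have hne : (pairFunctional i j : (Fin n → ℝ) →ₗ[ℝ] ℝ) ≠ 0 := fun h => by
    have h1 := LinearMap.congr_fun h (fun _ => 1)
    simp at h1
  rw [polyDim, hspan]
  have := Module.Dual.finrank_ker_add_one_of_ne_zero hne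
  rwa [Module.finrank_fin_fun] at this

lemma isFacet_pairFace (hd : IsFiniteMetric d) {i j : Fin n} (hij : i ≠ j) :
    IsFacet (metricPolyhedron d) (pairFace d s(i, j)) := by
  obtain ⟨x, hx, -⟩ := exists_tight_only_at_pair hd hij
  -- The sign is reversed because exposed faces consist of maximizers, whereas the face minimizes `x
  -- i + x j`.
  refine ⟨⟨x, hx⟩, fun _ => ⟨-pairFunctional i j, ?_⟩, ?_⟩
  · ext y
    rw [mem_pairFace_mk hd]
    refine and_congr_right fun hy => ⟨fun h z hz => ?_, fun h => ?_⟩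
    · have := hz i j
      simp only [neg_apply, pairFunctional_apply]
      linarith
    · have h1 := h x hx.1
      have h2 := ((mem_pairFace_mk hd).1 hx).2
      simp only [neg_apply, pairFunctional_apply] at h1
      exact le_antisymm (by linarith) (hy i j)
  · rw [polyDim_pairFace hd hij, polyDim_metricPolyhedron]

end Polyhedron

/-! ### The potential as a vertex, and strictness from genericity -/

section Cells

variable {n : ℕ} {d : Fin n → Fin n → ℝ} {Γ : SimpleGraph (Fin n)}

lemma mem_metricPolyhedron_of_potential (hd : IsFiniteMetric d)
    (hodd : ∀ v w : Fin n, ∃ p : Γ.Walk v w, Odd p.length) {h : Fin n → ℝ}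
    (heq : ∀ i j, Γ.Adj i j → h i + h j = d i j) (hle : ∀ i j, i ≠ j → d i j ≤ h i + h j) :
    h ∈ metricPolyhedron d := by
  intro i j
  by_cases hij : i = j
  · subst hij
    -- The diagonal constraint follows from an edge avoiding `i`: `h j + h k = d j k ≤ d j i + d i k
    -- ≤ h j + 2 * h i + h k`.
    obtain ⟨j, k, hjk, hj, hk⟩ := exists_edge_avoiding hodd i
    have h1 := heq j k hjk
    have h2 := hd.triangle j i k
    have h3 := hle j i hj
    have h4 := hle i k hk.symm
    rw [hd.self_eq_zero]
    linarith
  · exact hle i j hij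

lemma mem_extremePoints_of_potential (hodd : ∀ v w : Fin n, ∃ p : Γ.Walk v w, Odd p.length)
    {h : Fin n → ℝ} (heq : ∀ i j, Γ.Adj i j → h i + h j = d i j)
    (hmem : h ∈ metricPolyhedron d) : h ∈ (metricPolyhedron d).extremePoints ℝ := by
  refine ⟨hmem, fun x hx y hy hseg => ?_⟩
  obtain ⟨a, b, ha, hb, hab, rfl⟩ := hseg
  rw [← sub_eq_zero]
  refine eq_zero_of_edge_sums_eq_zero hodd _ fun i j hij => ?_
  have h1 := heq i j hij
  have h2 := hx i j
  have h3 := hy i j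
  simp only [Pi.add_apply, Pi.smul_apply, smul_eq_mul] at h1
  -- A constraint tight at an interior point of a segment in the polyhedron is tight at its
  -- endpoints.
  have hxt : x i + x j = d i j := by
    refine le_antisymm ?_ h2
    have h4 : a * (x i + x j) ≤ a * d i j := by
      have h5 := mul_le_mul_of_nonneg_left h3 hb.le
      have h6 : a * d i j + b * d i j = d i j := by rw [← add_mul, hab, one_mul]
      linarith
    exact le_of_mul_le_mul_left h4 ha
  simp only [Pi.sub_apply, Pi.add_apply, Pi.smul_apply, smul_eq_mul]
  linarith

/-- For a generic metric, a potential of `Γ` lying in the polyhedron is tight only on `Γ`. -/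
lemma lt_of_potential (hd : IsGenericMetric d) (hcard : Γ.edgeSet.ncard = n)
    (hodd : ∀ v w : Fin n, ∃ p : Γ.Walk v w, Odd p.length) {h : Fin n → ℝ}
    (heq : ∀ i j, Γ.Adj i j → h i + h j = d i j) (hmem : h ∈ metricPolyhedron d)
    {v w : Fin n} (hvw : v ≠ w) (hadj : ¬ Γ.Adj v w) : d v w < h v + h w := by
  refine (hmem v w).lt_of_ne fun htight => ?_
  have hfac := hd.2 h (mem_extremePoints_of_potential hodd heq hmem)
  rw [polyDim_metricPolyhedron] at hfac
  -- A tight non-edge would give `n + 1` distinct facets through the vertex `h`, where simplicity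
  -- allows only `n`.
  have hsub : pairFace d '' insert s(v, w) Γ.edgeSet ⊆
      {F | IsFacet (metricPolyhedron d) F ∧ h ∈ F} := by
    rintro _ ⟨e, he, rfl⟩
    induction e using Sym2.ind with | _ i j
    have hij : i ≠ j ∧ s(i, j) ∈ {e | h ∈ pairFace d e} := by
      rcases he with he | he
      · rw [he]
        refine ⟨?_, (mem_pairFace_mk hd.1).2 ⟨hmem, htight.symm⟩⟩
        rcases Sym2.eq_iff.mp he with ⟨rfl, rfl⟩ | ⟨rfl, rfl⟩
        exacts [hvw, hvw.symm]
      · exact ⟨SimpleGraph.Adj.ne he, (mem_pairFace_mk hd.1).2 ⟨hmem, heq i j he⟩⟩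
    exact ⟨isFacet_pairFace hd.1 hij.1, hij.2⟩
  have hinj : Set.InjOn (pairFace d) (insert s(v, w) Γ.edgeSet) :=
    (pairFace_injOn hd.1).mono <| by
      rintro e (rfl | he)
      exacts [hvw, SimpleGraph.not_isDiag_of_mem_edgeSet Γ he]
  have hle := Set.encard_le_encard hsub
  rw [hinj.encard_image, Set.encard_insert_of_notMem (by simpa using hadj),
    ← Set.Finite.cast_ncard_eq (Set.toFinite _), hcard, hfac] at hle
  have : n + 1 ≤ n := by exact_mod_cast hle
  omega

end Cells

theorem mainTheorem5 {n : ℕ} (d : Fin n → Fin n → ℝ) (hd : IsGenericMetric d)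
    (Γ : SimpleGraph (Fin n)) (hconn : Γ.Connected) (hcard : Γ.edgeSet.ncard = n)
    (htour : ¬ HasNontrivialEvenTour Γ) :
    (∀ v w : Fin n, v ≠ w → ¬ Γ.Adj v w → ∃ p : Γ.Walk v w, Odd p.length) ∧
    (Γ ∈ hypersimplexSubdivision d ↔
      ∀ v w : Fin n, v ≠ w → ¬ Γ.Adj v w →
        ∀ p : Γ.Walk v w, Odd p.length → d v w ≤ alternatingSum d p) ∧
    (Γ ∈ hypersimplexSubdivision d ↔
      ∀ v w : Fin n, v ≠ w → ¬ Γ.Adj v w →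
        ∃ p : Γ.Walk v w, Odd p.length ∧ d v w ≤ alternatingSum d p) := by
  obtain ⟨u, c, hc⟩ := exists_odd_closed_walk hconn hcard htour
  have hodd : ∀ v w : Fin n, ∃ p : Γ.Walk v w, Odd p.length := exists_odd_walk hconn hc
  obtain ⟨h, heq⟩ := exists_potential hcard hodd d hd.1.symm
  have hall : Γ ∈ hypersimplexSubdivision d → ∀ v w : Fin n, v ≠ w → ¬ Γ.Adj v w →
      ∀ p : Γ.Walk v w, Odd p.length → d v w ≤ alternatingSum d p := by
    rintro ⟨g, hg, hlt⟩ v w hvw hadj p hp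
    rw [alternatingSum_eq_add_of_odd d g hg p hp]
    exact (hlt v w hvw hadj).le
  have hcell : (∀ v w : Fin n, v ≠ w → ¬ Γ.Adj v w →
      ∃ p : Γ.Walk v w, Odd p.length ∧ d v w ≤ alternatingSum d p) →
      Γ ∈ hypersimplexSubdivision d := by
    intro hex
    have hmem : h ∈ metricPolyhedron d :=
      mem_metricPolyhedron_of_potential hd.1 hodd heq fun i j hij => by
        by_cases hadj : Γ.Adj i j
        · exact (heq i j hadj).ge
        · obtain ⟨p, hp, hle⟩ := hex i j hij hadj
          rwa [alternatingSum_eq_add_of_odd d h heq p hp] at hle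
    exact ⟨h, heq, fun i j hij hadj => lt_of_potential hd hcard hodd heq hmem hij hadj⟩
  have hex_of_all : (∀ v w : Fin n, v ≠ w → ¬ Γ.Adj v w →
      ∀ p : Γ.Walk v w, Odd p.length → d v w ≤ alternatingSum d p) →
      ∀ v w : Fin n, v ≠ w → ¬ Γ.Adj v w →
        ∃ p : Γ.Walk v w, Odd p.length ∧ d v w ≤ alternatingSum d p := by
    intro H v w hvw hadj
    obtain ⟨p, hp⟩ := hodd v w
    exact ⟨p, hp, H v w hvw hadj p hp⟩
  exact ⟨fun v w _ _ => hodd v w, ⟨hall, fun H => hcell (hex_of_all H)⟩,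
    ⟨fun H => hex_of_all (hall H), hcell⟩⟩
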